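/- Let $d\ge 1$, $k\ge 2$ and $m\ge 1$ be integers. In the Conway $(m,k)$-game on $\mathbb{Z}^d$ a cell may hold any number of checkers; at the start every cell whose vertical coordinate (its row) is at most $0$ holds $m$ checkers and all other cells are empty. In one move a checker at a cell $x$ jumps in a direction $v=\pm e_i$ over one checker on each of the $k-1$ cells $x+v,\dots,x+(k-1)v$ (which must all be occupied) and lands on $x+kv$; one checker is removed from each of the cells jumped over. Row $n$ is attainable if some finite sequence of moves brings a checker to a cell of row $n$, and $n_M$ denotes the maximum attainable row. Let $\phi_k\in(1,2)$ be the $k$-nacci constant, that is, the unique positive root of $x^k=1+x+\cdots+x^{k-1}$, and let $\varphi=\phi_2=\frac{1+\sqrt5}{2}$. **Theorem.** Let $d\ge1$. 1. Let $k\ge 2$. For every integer $m>1$ the maximum $n_M$ exists and $$\left\lfloor \log_{\phi_k} m+\log_{\phi_k}\frac{(\phi_k+1)^{d-1}}{(\phi_k-1)^d}\right\rfloor\ \le\ n_M\ \le\ \left\lfloor \log_{\phi_k} m+\log_{\phi_k}\frac{(\phi_k+1)^{d-1}}{(\phi_k-1)^d}\right\rfloor+1 .$$ Moreover, for fixed $d$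 and $k$, $n_M$ equals the upper bound for almost all $m$, i.e. for a set of positive integers $m$ of natural density $1$. 2. Let $k=2$. For every integer $m\ge1$ the maximum $n_M$ exists and $$\lfloor\log_\varphi m\rfloor+3d-2\ \le\ n_M\ \le\ \lfloor\log_\varphi m\rfloor+3d-1 ,$$ and again, for fixed $d$, $n_M$ equals the upper bound for a set of positive integers $m$ of natural density $1$. -/

import Mathlib

namespace ConwayCheckers

/-- A boardstate on `ℤ^d`: the number of checkers on each cell. -/
abbrev Board (d : ℕ) : Type := (Fin d → ℤ) → ℕ

/-- The row of a cell is its coordinate `0` (the vertical one). Initially every cell in row `0` or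
below holds `m` checkers, and every cell above row `0` is empty. -/
def initialBoard (d : ℕ) [NeZero d] (m : ℕ) : Board d :=
  fun x => if x 0 ≤ 0 then m else 0

/-- The `2 * d` unit directions of `ℤ^d`. -/
def IsUnitDirection {d : ℕ} (v : Fin d → ℤ) : Prop :=
  ∃ i : Fin d, v = Pi.single i 1 ∨ v = -Pi.single i 1

/-- One move from `B` to `B'`: a checker at `x` jumps in the unit direction `v` over one checker on
each of the `k - 1` cells `x + v, …, x + (k - 1) v` and lands on `x + k v`; the checkers jumped over
are removed. The subtraction never truncates, since the `k` cells `x + j v`, `j < k`, are distinct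
and occupied. -/
def Move {d : ℕ} (k : ℕ) (B B' : Board d) : Prop :=
  ∃ x v : Fin d → ℤ, IsUnitDirection v ∧
    (∀ j < k, 1 ≤ B (x + j • v)) ∧
    B' = B - (∑ j ∈ Finset.range k, Pi.single (x + j • v) 1) + Pi.single (x + k • v) 1

/-- `B` is attainable in the `(m, k)`-game on `ℤ^d` in finitely many moves. -/
def Attainable (d : ℕ) [NeZero d] (m k : ℕ) (B : Board d) : Prop :=
  Relation.ReflTransGen (Move k) (initialBoard d m) B

/-- The rows that some checker can occupy after finitely many moves of the `(m, k)`-game on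
`ℤ^d`. -/
def attainableRows (d : ℕ) [NeZero d] (m k : ℕ) : Set ℤ :=
  {n | ∃ B : Board d, Attainable d m k B ∧ ∃ x : Fin d → ℤ, x 0 = n ∧ 1 ≤ B x}

/-- The `k`-nacci constant (`k ≥ 2`): the only real number `x > 1` with
`x ^ k = 1 + x + ⋯ + x ^ (k - 1)`, see `knacciConst_eq_iff`. -/
noncomputable def knacciConst (k : ℕ) : ℝ :=
  sSup {x : ℝ | 1 < x ∧ x ^ k = ∑ j ∈ Finset.range k, x ^ j}

theorem knacci_root_unique {k : ℕ} (hk : 2 ≤ k) {x y : ℝ} (hx : 0 < x) (hy : 0 < y)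
    (hxk : x ^ k = ∑ j ∈ Finset.range k, x ^ j) (hyk : y ^ k = ∑ j ∈ Finset.range k, y ^ j) :
    x = y := by
  have key : ∀ {a b : ℝ}, 0 < a → a ^ k = ∑ j ∈ Finset.range k, a ^ j →
      b ^ k = ∑ j ∈ Finset.range k, b ^ j → ¬ a < b := by
    intro a b ha hak hbk hab
    have hb : 0 < b := ha.trans hab
    have h : ∑ j ∈ Finset.range k, a ^ k * b ^ j < ∑ j ∈ Finset.range k, b ^ k * a ^ j := by
      refine Finset.sum_lt_sum_of_nonempty ⟨0, by simp; omega⟩ fun j hj => ?_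
      obtain ⟨i, rfl⟩ := Nat.exists_eq_add_of_lt (Finset.mem_range.mp hj)
      have h1 : a ^ (i + 1) < b ^ (i + 1) := pow_lt_pow_left₀ hab ha.le (by omega)
      have h2 : 0 < a ^ j * b ^ j := by positivity
      calc a ^ (j + i + 1) * b ^ j = (a ^ j * b ^ j) * a ^ (i + 1) := by ring
        _ < (a ^ j * b ^ j) * b ^ (i + 1) := mul_lt_mul_of_pos_left h1 h2
        _ = b ^ (j + i + 1) * a ^ j := by ring
    rw [← Finset.mul_sum, ← Finset.mul_sum, ← hak, ← hbk, mul_comm] at h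
    exact lt_irrefl _ h
  exact le_antisymm (not_lt.mp (key hy hyk hxk)) (not_lt.mp (key hx hxk hyk))

theorem exists_knacci_root {k : ℕ} (hk : 2 ≤ k) :
    ∃ x : ℝ, 1 < x ∧ x < 2 ∧ x ^ k = ∑ j ∈ Finset.range k, x ^ j := by
  have hcont : ContinuousOn (fun x : ℝ => x ^ k - ∑ j ∈ Finset.range k, x ^ j)
      (Set.Icc 1 2) := by fun_prop
  have h2 : ∑ j ∈ Finset.range k, (2 : ℝ) ^ j = 2 ^ k - 1 := by
    rw [geom_sum_eq (by norm_num)]; norm_num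
  have hk' : (2 : ℝ) ≤ k := by exact_mod_cast hk
  obtain ⟨x, hx, h0⟩ := intermediate_value_Ioo (by norm_num : (1 : ℝ) ≤ 2) hcont
    (show (0 : ℝ) ∈ Set.Ioo _ _ by
      refine ⟨?_, ?_⟩
      · simp; linarith
      · simp [h2])
  exact ⟨x, hx.1, hx.2, sub_eq_zero.mp h0⟩

/-- For `k ≥ 2` the `k`-nacci constant is the only positive root of
`1 + x + ⋯ + x ^ (k - 1) - x ^ k`, and it lies in `(1, 2)`. -/
theorem knacciConst_spec {k : ℕ} (hk : 2 ≤ k) :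
    1 < knacciConst k ∧ knacciConst k < 2 ∧
      knacciConst k ^ k = ∑ j ∈ Finset.range k, knacciConst k ^ j := by
  obtain ⟨x, h1, h2, h3⟩ := exists_knacci_root hk
  have hset : {x : ℝ | 1 < x ∧ x ^ k = ∑ j ∈ Finset.range k, x ^ j} = {x} := by
    ext y
    refine ⟨fun hy => ?_, ?_⟩
    · exact knacci_root_unique hk (by linarith [hy.1]) (by linarith) hy.2 h3
    · rintro rfl
      exact ⟨h1, h3⟩
  have : knacciConst k = x := by rw [knacciConst, hset, csSup_singleton]
  rw [this]
  exact ⟨h1, h2, h3⟩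

theorem knacciConst_eq_iff {k : ℕ} (hk : 2 ≤ k) {x : ℝ} (hx : 0 < x) :
    x = knacciConst k ↔ x ^ k = ∑ j ∈ Finset.range k, x ^ j := by
  obtain ⟨h1, -, h3⟩ := knacciConst_spec hk
  refine ⟨?_, fun h => knacci_root_unique hk hx (by linarith) h h3⟩
  rintro rfl
  exact h3

/-- `P m` holds for almost all positive integers `m`: the set of such `m` has natural
density `1`. -/
def ForAlmostAllNat (P : ℕ → Prop) : Prop :=
  Filter.Tendsto (fun N : ℕ => ({m : ℕ | 1 ≤ m ∧ m ≤ N ∧ P m}.ncard : ℝ) / N)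
    Filter.atTop (nhds 1)

/-- The integer `⌊log_φ m + log_φ ((φ + 1) ^ (d - 1) / (φ - 1) ^ d)⌋`, where `φ` is the `k`-nacci
constant. -/
noncomputable def rowBound (d m k : ℕ) : ℤ :=
  ⌊Real.logb (knacciConst k) m +
    Real.logb (knacciConst k) ((knacciConst k + 1) ^ (d - 1) / (knacciConst k - 1) ^ d)⌋

end ConwayCheckers

/-!
A checker at taxicab distance `D` from a fixed cell `y` is given the weight `φ ^ (-D)`, where `φ` is
the `k`-nacci constant. As `φ⁻¹ + ⋯ + φ⁻ᵏ = 1`, no move increases the total weight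
(`Move.boardWeight_le`). A board with a checker at `y` weighs at least `1`, and the initial board,
seen from a cell of row `n + 1`, weighs `m * gain d k / φ ^ n`, a product of geometric series. This
gives the upper bound, `pow_le_of_mem_attainableRows`.

For the lower bound the game is played backwards: a checker demanded at a cell may be replaced by
checkers demanded on the next `k` cells of a ray. Surplus checkers never obstruct a move, so the
relation `Yields` is a preorder compatible with addition, and demands can be treated separately. On
a single ray the greedy strategy is optimal: as long as the demand on the first cell exceeds what
the ray holds there, all of it is used and the rest is passed on, so nothing is wasted, and the
demands stay nonincreasing along the ray, so that everything is met at the first cell where the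
demand does not exceed the stock (`yields_window`). Hence a ray yields any integer number of
checkers lighter than itself. Gathering every line of a horizontal direction onto its middle cell
removes one dimension and multiplies the number of checkers per cell by `r = (φ + 1) / (φ - 1)`, up
to a rounding loss (`Supplies.collapse`). The rounded numbers satisfy
`A' - (φ - 1) ≥ r (A - (φ - 1))`, so all losses together cost at most `φ - 1` initial checkers
per cell, and the half-line that is left brings a checker to row `n + 1` as soon as
`φ ^ n ≤ (m - (φ - 1)) * gain d k` (`mem_attainableRows_of_pow_le`).

For `m ≥ 2 > φ` this loss is at most a factor `φ`, that is, at most one row. It makes the upper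
bound fail only if `m * gain d k` is within a bounded distance above a power of `φ`, which happens
for `O(log N)` values of `m ≤ N` and hence with density `0`. For `k = 2` and `m = 1` the same works
in dimension at most `2`; in higher dimension the rounded collapses of the first two dimensions,
which give `1 → 3 → 11` checkers, are just too lossy, and `yields_plane` gathers `12` instead.
-/

namespace ConwayCheckers

/-! ### Moves and what a board yields -/

/-- The board with a single checker, at the cell `x`. -/
def checker {d : ℕ} (x : Fin d → ℤ) : Board d := Pi.single x 1

/-- `B` yields `T` if some finite sequence of moves from `B` leads to a board that has at least the
checkers of `T`. This is a preorder compatible with addition, since surplus checkers never obstruct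
a move. -/
def Yields {d : ℕ} (k : ℕ) (B T : Board d) : Prop :=
  ∃ R : Board d, Relation.ReflTransGen (Move k) B (T + R)

theorem IsUnitDirection.ne_zero {d : ℕ} {v : Fin d → ℤ} (hv : IsUnitDirection v) : v ≠ 0 := by
  obtain ⟨i, rfl | rfl⟩ := hv <;> simp

theorem IsUnitDirection.neg {d : ℕ} {v : Fin d → ℤ} (hv : IsUnitDirection v) :
    IsUnitDirection (-v) := by
  obtain ⟨i, rfl | rfl⟩ := hv
  · exact ⟨i, Or.inr rfl⟩
  · exact ⟨i, Or.inl (neg_neg _)⟩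

theorem isUnitDirection_single {d : ℕ} (i : Fin d) : IsUnitDirection (Pi.single i (1 : ℤ)) :=
  ⟨i, Or.inl rfl⟩

/-- The `k` cells that a move needs are distinct, so a board on which they are occupied dominates
the sum of the corresponding checkers. -/
theorem sum_checker_le {d k : ℕ} {B : Board d} {x v : Fin d → ℤ} (hv : v ≠ 0)
    (h : ∀ j < k, 1 ≤ B (x + j • v)) : ∑ j ∈ Finset.range k, checker (x + j • v) ≤ B := by
  intro z
  have hinj : Function.Injective fun j : ℕ => x + j • v := by
    intro j j' hjj
    have h1 : j • v = j' • v := add_left_cancel hjj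
    obtain ⟨i, hi⟩ := Function.ne_iff.mp hv
    have h2 := congrFun h1 i
    have hi' : v i ≠ 0 := hi
    simpa [hi'] using h2
  rw [Finset.sum_apply]
  by_cases hz : ∃ j < k, x + j • v = z
  · obtain ⟨j, hj, rfl⟩ := hz
    rw [Finset.sum_eq_single_of_mem j (Finset.mem_range.mpr hj)]
    · simpa [checker] using h j hj
    · intro b _ hb
      exact Pi.single_eq_of_ne (fun h => hb (hinj h).symm) _
  · push Not at hz
    rw [Finset.sum_eq_zero]
    · exact Nat.zero_le _
    · intro j hj
      exact Pi.single_eq_of_ne (fun h => hz j (Finset.mem_range.mp hj) h.symm) _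

theorem move_iff {d k : ℕ} {B B' : Board d} :
    Move k B B' ↔ ∃ x v : Fin d → ℤ, IsUnitDirection v ∧
      ∑ j ∈ Finset.range k, checker (x + j • v) ≤ B ∧
      B' = B - ∑ j ∈ Finset.range k, checker (x + j • v) + checker (x + k • v) := by
  constructor
  · rintro ⟨x, v, hv, h, rfl⟩
    exact ⟨x, v, hv, sum_checker_le hv.ne_zero h, rfl⟩
  · rintro ⟨x, v, hv, h, rfl⟩
    refine ⟨x, v, hv, fun j hj => ?_, rfl⟩
    refine le_trans ?_ (h (x + j • v))
    rw [Finset.sum_apply]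
    refine le_trans ?_ (Finset.single_le_sum (fun _ _ => Nat.zero_le _) (Finset.mem_range.mpr hj))
    simp [checker]

theorem Move.add_right {d k : ℕ} {B B' : Board d} (h : Move k B B') (C : Board d) :
    Move k (B + C) (B' + C) := by
  obtain ⟨x, v, hv, hle, rfl⟩ := move_iff.mp h
  refine move_iff.mpr ⟨x, v, hv, hle.trans le_self_add, ?_⟩
  funext z
  have := hle z
  simp only [Pi.add_apply, Pi.sub_apply] at this ⊢
  omega

theorem reach_add_right {d k : ℕ} {B B' : Board d}
    (h : Relation.ReflTransGen (Move k) B B') (C : Board d) :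
    Relation.ReflTransGen (Move k) (B + C) (B' + C) := by
  induction h with
  | refl => exact .refl
  | tail _ h ih => exact ih.tail (h.add_right C)

theorem yields_of_le {d k : ℕ} {B T : Board d} (h : T ≤ B) : Yields k B T :=
  ⟨B - T, by rw [add_tsub_cancel_of_le h]⟩

theorem Yields.trans {d k : ℕ} {B T U : Board d} (h₁ : Yields k B T)
    (h₂ : Yields k T U) : Yields k B U := by
  obtain ⟨R, hR⟩ := h₁
  obtain ⟨Q, hQ⟩ := h₂
  exact ⟨Q + R, by rw [← add_assoc]; exact hR.trans (reach_add_right hQ R)⟩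

theorem Yields.add {d k : ℕ} {B T B' T' : Board d} (h₁ : Yields k B T)
    (h₂ : Yields k B' T') : Yields k (B + B') (T + T') := by
  obtain ⟨R, hR⟩ := h₁
  obtain ⟨Q, hQ⟩ := h₂
  refine ⟨R + Q, (reach_add_right hR B').trans ?_⟩
  have := reach_add_right hQ (T + R)
  rw [add_comm B'] at this
  convert this using 1
  abel

theorem yields_sum {ι : Type*} {d k : ℕ} (s : Finset ι) {B T : ι → Board d}
    (h : ∀ i ∈ s, Yields k (B i) (T i)) : Yields k (∑ i ∈ s, B i) (∑ i ∈ s, T i) := by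
  classical
  induction s using Finset.induction_on with
  | empty => exact yields_of_le le_rfl
  | insert a s ha ih =>
    rw [Finset.sum_insert ha, Finset.sum_insert ha]
    exact (h a (Finset.mem_insert_self a s)).add
      (ih fun i hi => h i (Finset.mem_insert_of_mem hi))

theorem Yields.nsmul {d k : ℕ} {B T : Board d} (h : Yields k B T) (n : ℕ) :
    Yields k (n • B) (n • T) := by
  simpa using yields_sum (Finset.range n) (B := fun _ => B) (T := fun _ => T) fun _ _ => h

/-- A single jump: `k` checkers in a row, next to the cell `p`, yield one checker at `p`. -/
theorem yields_jump {d k : ℕ} {v : Fin d → ℤ} (hv : IsUnitDirection v)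
    (p : Fin d → ℤ) :
    Yields k (∑ j ∈ Finset.range k, checker (p - (j + 1) • v)) (checker p) := by
  have hsum : ∑ j ∈ Finset.range k, checker (p - (j + 1) • v) =
      ∑ j ∈ Finset.range k, checker (p - k • v + j • v) := by
    rw [← Finset.sum_range_reflect]
    refine Finset.sum_congr rfl fun j hj => ?_
    have hj := Finset.mem_range.mp hj
    obtain ⟨i, rfl⟩ : ∃ i, k = j + 1 + i := ⟨k - (j + 1), by omega⟩
    congr 1
    rw [show j + 1 + i - 1 - j + 1 = i + 1 by omega, add_smul, add_smul, add_smul]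
    abel
  refine ⟨0, Relation.ReflTransGen.single (move_iff.mpr ⟨p - k • v, v, hv, hsum.ge, ?_⟩)⟩
  rw [hsum, tsub_self, zero_add, add_zero, sub_add_cancel]

/-! ### Gathering checkers along rays and lines -/

theorem sum_inv_knacciConst_pow {k : ℕ} (hk : 2 ≤ k) :
    ∑ j ∈ Finset.range k, (knacciConst k)⁻¹ ^ j = knacciConst k := by
  obtain ⟨h1, -, h3⟩ := knacciConst_spec hk
  set x := knacciConst k
  have hx : x ≠ 0 := by positivity
  have hxk : x ^ (k - 1) ≠ 0 := pow_ne_zero _ hx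
  have : x ^ (k - 1) * ∑ j ∈ Finset.range k, x⁻¹ ^ j = ∑ j ∈ Finset.range k, x ^ j := by
    rw [← Finset.sum_range_reflect (fun j => x ^ j), Finset.mul_sum]
    refine Finset.sum_congr rfl fun j hj => ?_
    have hj := Finset.mem_range.mp hj
    obtain ⟨i, rfl⟩ : ∃ i, k = j + 1 + i := ⟨k - (j + 1), by omega⟩
    rw [show j + 1 + i - 1 - j = i by omega, show j + 1 + i - 1 = i + j by omega, pow_add,
      inv_pow, mul_assoc, mul_inv_cancel₀ (pow_ne_zero _ hx), mul_one]
  rw [← h3] at this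
  apply mul_left_cancel₀ hxk
  rw [this, ← pow_succ, Nat.sub_add_cancel (by omega)]

/-- Checkers are demanded on the `k` cells `p, p - v, …, p - (k - 1) v`, in nonincreasing numbers
`a 0 ≥ a 1 ≥ ⋯`, while the ray `p, p - v, p - 2 v, …` holds nondecreasing numbers `c 0 ≤ c 1 ≤ ⋯`.
The demand can be met as soon as its weight is below the weight of the ray. If `a 0 ≤ c 0`, it is
met outright by monotonicity. Otherwise all of `c 0` is used up at `p` and the missing `a 0 - c 0`
checkers are demanded from jumps into `p`; this conserves the weight and keeps the new demand, on
the cells `p - v, …, p - k v`, nonincreasing. -/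
theorem yields_window {d k : ℕ} (hk : 2 ≤ k) {v : Fin d → ℤ} (hv : IsUnitDirection v) (L : ℕ) :
    ∀ {c a : ℕ → ℕ} (p : Fin d → ℤ), Monotone c → Antitone a → a k = 0 →
      ∑ j ∈ Finset.range k, (a j : ℝ) * (knacciConst k)⁻¹ ^ j <
        ∑ t ∈ Finset.range L, (c t : ℝ) * (knacciConst k)⁻¹ ^ t →
      Yields k (∑ t ∈ Finset.range (L + k), c t • checker (p - t • v))
        (∑ j ∈ Finset.range k, a j • checker (p - j • v)) := by
  obtain ⟨h1, -, -⟩ := knacciConst_spec hk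
  have hgeom := sum_inv_knacciConst_pow hk
  set x := knacciConst k
  have hx : x ≠ 0 := by positivity
  induction L with
  | zero =>
    intro c a p _ _ _ h
    have : 0 ≤ ∑ j ∈ Finset.range k, (a j : ℝ) * x⁻¹ ^ j :=
      Finset.sum_nonneg fun _ _ => by positivity
    simp only [Finset.range_zero, Finset.sum_empty] at h
    linarith
  | succ L ih =>
    intro c a p hc ha hak h
    rcases le_or_gt (a 0) (c 0) with hle | hlt
    · refine yields_of_le (le_trans (Finset.sum_le_sum fun j _ => ?_)
        (Finset.sum_le_sum_of_subset (Finset.range_subset_range.mpr (by omega : k ≤ L + 1 + k))))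
      exact nsmul_le_nsmul_left (fun _ => Nat.zero_le _)
        ((ha (Nat.zero_le j)).trans (hle.trans (hc (Nat.zero_le j))))
    · obtain ⟨e, he⟩ : ∃ e, a 0 = c 0 + e := ⟨a 0 - c 0, by omega⟩
      have hpv : ∀ t : ℕ, p - (t + 1) • v = p - v - t • v := fun t => by
        rw [add_comm t 1, add_smul, one_smul, sub_sub]
      have hcut : ∑ j ∈ Finset.range k, (if j < k then a (j + 1) + e else 0 : ℕ) •
          checker (p - v - j • v) = ∑ j ∈ Finset.range k, a (j + 1) • checker (p - (j + 1) • v) +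
            e • ∑ j ∈ Finset.range k, checker (p - (j + 1) • v) := by
        rw [Finset.smul_sum, ← Finset.sum_add_distrib]
        refine Finset.sum_congr rfl fun j hj => ?_
        rw [if_pos (Finset.mem_range.mp hj), add_smul, hpv]
      have key := ih (c := fun t => c (t + 1)) (a := fun j => if j < k then a (j + 1) + e else 0)
        (p - v) (fun s t hst => hc (by omega)) ?_ (by simp) ?_
      · rw [hcut] at key
        rw [show L + 1 + k = (L + k) + 1 by omega, Finset.sum_range_succ' _ (L + k)]
        have hsum : ∑ t ∈ Finset.range (L + k), c (t + 1) • checker (p - (t + 1) • v) =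
            ∑ t ∈ Finset.range (L + k), c (t + 1) • checker (p - v - t • v) := by
          exact Finset.sum_congr rfl fun t _ => by rw [hpv]
        have hgoal : ∑ j ∈ Finset.range k, a j • checker (p - j • v) =
            ∑ j ∈ Finset.range k, a (j + 1) • checker (p - (j + 1) • v) + e • checker p +
              c 0 • checker p := by
          have h2 := Finset.sum_range_succ (fun j => a j • checker (p - j • v)) k
          rw [hak, zero_smul, add_zero, Finset.sum_range_succ'] at h2
          rw [← h2, he, zero_smul, sub_zero, add_smul]
          abel
        rw [hsum, hgoal, zero_smul, sub_zero]
        refine (key.add (yields_of_le le_rfl)).trans ?_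
        refine Yields.add (Yields.add (yields_of_le le_rfl) ?_) (yields_of_le le_rfl)
        exact (yields_jump hv p).nsmul e
      · intro i j hij
        have := ha (show i + 1 ≤ j + 1 by omega)
        dsimp only
        split_ifs <;> omega
      · have h3 : ∑ j ∈ Finset.range k, ((if j < k then a (j + 1) + e else 0 : ℕ) : ℝ) * x⁻¹ ^ j =
            ∑ j ∈ Finset.range k, (a (j + 1) : ℝ) * x⁻¹ ^ j + e * x := by
          rw [← hgeom, Finset.mul_sum, ← Finset.sum_add_distrib]
          refine Finset.sum_congr rfl fun j hj => ?_
          rw [if_pos (Finset.mem_range.mp hj)]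
          push_cast
          rw [add_mul, hgeom]
        have hshift : ∀ (b : ℕ → ℕ) (n : ℕ), ∑ j ∈ Finset.range (n + 1), (b j : ℝ) * x⁻¹ ^ j =
            x⁻¹ * ∑ j ∈ Finset.range n, (b (j + 1) : ℝ) * x⁻¹ ^ j + b 0 := by
          intro b n
          rw [Finset.sum_range_succ', Finset.mul_sum]
          simp only [pow_zero, mul_one]
          congr 1
          exact Finset.sum_congr rfl fun j _ => by ring
        have h4 := Finset.sum_range_succ (fun j => (a j : ℝ) * x⁻¹ ^ j) k
        rw [hak, Nat.cast_zero, zero_mul, add_zero, hshift] at h4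
        rw [← h4, hshift] at h
        have he' : (a 0 : ℝ) = c 0 + e := by exact_mod_cast he
        rw [h3]
        rw [he'] at h
        have h5 : x⁻¹ * (∑ j ∈ Finset.range k, (a (j + 1) : ℝ) * x⁻¹ ^ j + e * x) <
            x⁻¹ * ∑ j ∈ Finset.range L, (c (j + 1) : ℝ) * x⁻¹ ^ j := by
          have : x⁻¹ * (e * x) = (e : ℝ) := by field_simp
          rw [mul_add, this]
          linarith
        exact lt_of_mul_lt_mul_left h5 (by positivity)

/-- A ray with nondecreasing numbers of checkers yields `e` checkers at its origin `p` if they weigh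
less than the ray. -/
theorem yields_ray {d k : ℕ} (hk : 2 ≤ k) {v : Fin d → ℤ} (hv : IsUnitDirection v) {L e : ℕ}
    {c : ℕ → ℕ} (p : Fin d → ℤ) (hc : Monotone c)
    (h : (e : ℝ) < ∑ t ∈ Finset.range L, (c t : ℝ) * (knacciConst k)⁻¹ ^ (t + 1)) :
    Yields k (∑ t ∈ Finset.range (L + k), c t • checker (p - (t + 1) • v)) (e • checker p) := by
  obtain ⟨h1, -, -⟩ := knacciConst_spec hk
  have hpv : ∀ t : ℕ, p - (t + 1) • v = p - v - t • v := fun t => by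
    rw [add_comm t 1, add_smul, one_smul, sub_sub]
  refine Yields.trans ?_ ((yields_jump hv p).nsmul e)
  have key := yields_window hk hv L (c := c) (a := fun j => if j < k then e else 0) (p - v) hc
    (fun i j hij => by dsimp only; split_ifs <;> omega) (by simp) ?_
  · simp only [hpv, Finset.smul_sum]
    convert key using 1
    exact Finset.sum_congr rfl fun j hj => by rw [if_pos (Finset.mem_range.mp hj)]
  · have h2 : ∑ j ∈ Finset.range k, ((if j < k then e else 0 : ℕ) : ℝ) * (knacciConst k)⁻¹ ^ j =
        e * knacciConst k := by
      conv_rhs => rw [← sum_inv_knacciConst_pow hk, Finset.mul_sum]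
      exact Finset.sum_congr rfl fun j hj => by
        rw [if_pos (Finset.mem_range.mp hj)]
    have h3 : ∑ t ∈ Finset.range L, (c t : ℝ) * (knacciConst k)⁻¹ ^ (t + 1) =
        (∑ t ∈ Finset.range L, (c t : ℝ) * (knacciConst k)⁻¹ ^ t) / knacciConst k := by
      rw [Finset.sum_div]
      exact Finset.sum_congr rfl fun t _ => by rw [pow_succ, div_eq_mul_inv, mul_assoc]
    rw [h3, lt_div_iff₀ (by positivity)] at h
    rw [h2]
    exact h

theorem exists_lt_sum_inv_knacciConst_pow {k : ℕ} (hk : 2 ≤ k) {y : ℝ}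
    (hy : y * (knacciConst k - 1) < 1) :
    ∃ L, y < ∑ t ∈ Finset.range L, (knacciConst k)⁻¹ ^ (t + 1) := by
  obtain ⟨h1, -, -⟩ := knacciConst_spec hk
  set x := knacciConst k
  have hx : x ≠ 0 := by positivity
  have hx1 : x - 1 ≠ 0 := by linarith
  have hsum : HasSum (fun t : ℕ => x⁻¹ ^ (t + 1)) (x⁻¹ * (1 - x⁻¹)⁻¹) := by
    simp only [pow_succ']
    exact (hasSum_geometric_of_lt_one (by positivity) (inv_lt_one_of_one_lt₀ h1)).mul_left _
  have hval : x⁻¹ * (1 - x⁻¹)⁻¹ = 1 / (x - 1) := by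
    have : 1 - x⁻¹ = (x - 1) / x := by field_simp
    rw [this]
    field_simp
  rw [hval] at hsum
  have hlt : y < 1 / (x - 1) := by rwa [lt_div_iff₀ (by linarith)]
  exact (hsum.tendsto_sum_nat.eventually_const_lt hlt).exists

theorem sum_Icc_neg {M : Type*} [AddCommMonoid M] (f : ℤ → M) (n : ℕ) :
    ∑ t ∈ Finset.Icc (-n : ℤ) n, f t =
      f 0 + ∑ t ∈ Finset.range n, f (t + 1) + ∑ t ∈ Finset.range n, f (-(t + 1)) := by
  induction n with
  | zero => simp
  | succ n ih =>
    have h : Finset.Icc (-(n + 1 : ℕ) : ℤ) (n + 1 : ℕ) =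
        insert (-(n + 1 : ℤ)) (insert (n + 1 : ℤ) (Finset.Icc (-n : ℤ) n)) := by
      ext t
      simp only [Finset.mem_Icc, Finset.mem_insert]
      omega
    rw [h, Finset.sum_insert, Finset.sum_insert, ih, Finset.sum_range_succ, Finset.sum_range_succ]
    · abel
    · simp
    · simp
      omega

/-- A line all of whose cells hold `m` checkers yields `m + 2 e` checkers at any of its cells `p`,
for any `e` lighter than a half-line: `e` further checkers come from either side. -/
theorem yields_line {d k : ℕ} (hk : 2 ≤ k) {m e : ℕ} (he : e * (knacciConst k - 1) < m) :
    ∃ L : ℕ, ∀ {v : Fin d → ℤ}, IsUnitDirection v → ∀ p : Fin d → ℤ,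
      Yields k (m • ∑ t ∈ Finset.Icc (-L : ℤ) L, checker (p + t • v))
        ((m + 2 * e) • checker p) := by
  obtain ⟨h1, -, -⟩ := knacciConst_spec hk
  have hm : (0 : ℝ) < m := lt_of_le_of_lt (mul_nonneg (Nat.cast_nonneg e) (by linarith)) he
  obtain ⟨L, hL⟩ := exists_lt_sum_inv_knacciConst_pow hk (y := e / m)
    (by rw [div_mul_eq_mul_div, div_lt_one hm]; exact he)
  rw [div_lt_iff₀' hm, Finset.mul_sum] at hL
  refine ⟨L + k, fun {v} hv p => ?_⟩
  have h₁ := yields_ray hk hv (c := fun _ => m) p monotone_const hL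
  have h₂ := yields_ray hk hv.neg (c := fun _ => m) p monotone_const hL
  have h := ((yields_of_le (k := k) (le_refl (m • checker p))).add h₂).add h₁
  rw [← Finset.smul_sum, ← Finset.smul_sum] at h
  convert h using 1
  · rw [sum_Icc_neg, smul_add, smul_add, zero_smul, add_zero]
    congr 1
    · congr 2
      refine Finset.sum_congr rfl fun t _ => ?_
      rw [smul_neg, sub_neg_eq_add]
      norm_cast
    · congr 1
      refine Finset.sum_congr rfl fun t _ => ?_
      rw [neg_smul, ← sub_eq_add_neg]
      norm_cast
  · rw [add_smul, two_mul, add_smul, add_assoc]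

/-! ### Collapsing one dimension at a time -/

/-- `B` supplies `m` checkers on each cell of `S`: it yields `m` checkers simultaneously on all
cells of any given finite part of `S`. -/
def Supplies {d : ℕ} (k : ℕ) (B : Board d) (S : Set (Fin d → ℤ)) (m : ℕ) : Prop :=
  ∀ T : Finset (Fin d → ℤ), ↑T ⊆ S → Yields k B (m • ∑ y ∈ T, checker y)

/-- If the translates `y + F` of a finite pattern by the cells `y` of `S'` are disjoint parts of
`S`, and gathering over each of them gives `A` checkers at `y`, then a supply on `S` gives a supply
of `A` checkers on `S'`. -/
theorem Supplies.of_pattern {d k : ℕ} {B : Board d} {S S' : Set (Fin d → ℤ)} {m A : ℕ}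
    (h : Supplies k B S m) (F : Finset (Fin d → ℤ)) (hF : ∀ y ∈ S', ∀ f ∈ F, y + f ∈ S)
    (hinj : ∀ y ∈ S', ∀ y' ∈ S', ∀ f ∈ F, ∀ f' ∈ F, y + f = y' + f' → y = y')
    (hy : ∀ y ∈ S', Yields k (m • ∑ f ∈ F, checker (y + f)) (A • checker y)) :
    Supplies k B S' A := by
  classical
  intro T hT
  have h₁ := h ((T ×ˢ F).image fun q => q.1 + q.2) (by
    intro z hz
    obtain ⟨q, hq, rfl⟩ := Finset.mem_image.mp (Finset.mem_coe.mp hz)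
    obtain ⟨hq₁, hq₂⟩ := Finset.mem_product.mp hq
    exact hF _ (hT hq₁) _ hq₂)
  rw [Finset.sum_image, Finset.sum_product, Finset.smul_sum] at h₁
  · rw [Finset.smul_sum]
    exact h₁.trans (yields_sum T fun y hyT => hy y (hT hyT))
  · rintro ⟨y, f⟩ hq ⟨y', f'⟩ hq' heq
    have hq := Finset.mem_product.mp (Finset.mem_coe.mp hq)
    have hq' := Finset.mem_product.mp (Finset.mem_coe.mp hq')
    have hyy := hinj y (hT hq.1) y' (hT hq'.1) f hq.2 f' hq'.2 heq
    subst hyy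
    exact Prod.ext rfl (add_left_cancel (a := y) heq)

/-- The cells of the initial half-space whose horizontal coordinates with index at most `j`
vanish. -/
def slice (d : ℕ) [NeZero d] (j : ℕ) : Set (Fin d → ℤ) :=
  {x | x 0 ≤ 0 ∧ ∀ i : Fin d, i ≠ 0 → i.val ≤ j → x i = 0}

theorem supplies_initialBoard (d : ℕ) [NeZero d] (k m : ℕ) :
    Supplies k (initialBoard d m) (slice d 0) m := by
  intro T hT
  refine yields_of_le fun z => ?_
  rw [Pi.smul_apply, Finset.sum_apply]
  by_cases hz : z ∈ T
  · have hz0 : z 0 ≤ 0 := (hT hz).1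
    rw [Finset.sum_eq_single_of_mem z hz fun y _ hy => Pi.single_eq_of_ne hy.symm _]
    simp [checker, initialBoard, hz0]
  · rw [Finset.sum_eq_zero fun y hy => Pi.single_eq_of_ne (fun h : z = y => hz (h ▸ hy)) _]
    simp

/-- Collapsing one horizontal dimension multiplies the supply by `(φ + 1) / (φ - 1)`, up to a
rounding loss; `φ - 1` is the fixed point of the resulting affine recursion. -/
theorem Supplies.collapse {d k : ℕ} [NeZero d] (hk : 2 ≤ k) {B : Board d} {j A : ℕ}
    (hA : 1 ≤ A) (hj : j + 1 < d) (h : Supplies k B (slice d j) A) :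
    ∃ A', 1 ≤ A' ∧ Supplies k B (slice d (j + 1)) A' ∧
      (knacciConst k + 1) / (knacciConst k - 1) * (A - (knacciConst k - 1)) ≤
        A' - (knacciConst k - 1) := by
  obtain ⟨h1, -, -⟩ := knacciConst_spec hk
  set x := knacciConst k
  have hx : 0 < x - 1 := by linarith
  have hA0 : (0 : ℝ) < A := by exact_mod_cast hA
  -- the largest integer strictly below the weight `A / (x - 1)` of a half-line
  set e := ⌈(A : ℝ) / (x - 1)⌉₊ - 1
  have hpos : 0 < ⌈(A : ℝ) / (x - 1)⌉₊ := Nat.ceil_pos.mpr (by positivity)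
  have he1 : (e : ℝ) + 1 = ⌈(A : ℝ) / (x - 1)⌉₊ := by
    exact_mod_cast Nat.sub_add_cancel hpos
  have he_lt : (e : ℝ) * (x - 1) < A := by
    rw [← lt_div_iff₀ hx]
    have := Nat.ceil_lt_add_one (a := (A : ℝ) / (x - 1)) (by positivity)
    linarith
  have he_ge : (A : ℝ) / (x - 1) - 1 ≤ e := by
    have := Nat.le_ceil ((A : ℝ) / (x - 1))
    linarith
  obtain ⟨L, hL⟩ := yields_line (d := d) hk he_lt
  set i : Fin d := ⟨j + 1, hj⟩
  have hi : i ≠ 0 := by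
    intro h0
    have := congrArg Fin.val h0
    simp [i] at this
  set v : Fin d → ℤ := Pi.single i 1
  have hvi : ∀ t : ℤ, (t • v) i = t := fun t => by simp [v]
  have hvn : ∀ (t : ℤ) (l : Fin d), l ≠ i → (t • v) l = 0 := fun t l hl => by simp [v, hl]
  refine ⟨A + 2 * e, by omega, ?_, ?_⟩
  · refine h.of_pattern ((Finset.Icc (-L : ℤ) L).image fun t => t • v) ?_ ?_ ?_
    · rintro y ⟨hy0, hy⟩ f hf
      obtain ⟨t, -, rfl⟩ := Finset.mem_image.mp hf
      refine ⟨?_, fun l hl hlj => ?_⟩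
      · rw [Pi.add_apply, hvn t 0 hi.symm, add_zero]
        exact hy0
      · have hli : l ≠ i := by
          rintro rfl
          simp [i] at hlj
        rw [Pi.add_apply, hvn t l hli, hy l hl (by omega), add_zero]
    · rintro y ⟨-, hy⟩ y' ⟨-, hy'⟩ f hf f' hf' heq
      obtain ⟨t, -, rfl⟩ := Finset.mem_image.mp hf
      obtain ⟨t', -, rfl⟩ := Finset.mem_image.mp hf'
      have := congrFun heq i
      rw [Pi.add_apply, Pi.add_apply, hvi, hvi, hy i hi le_rfl, hy' i hi le_rfl, zero_add,
        zero_add] at this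
      subst this
      exact add_right_cancel heq
    · intro y _
      rw [Finset.sum_image]
      · exact hL (isUnitDirection_single i) y
      · intro t _ t' _ heq
        simpa only [hvi] using congrFun heq i
  · push_cast
    have : (x + 1) / (x - 1) * (A - (x - 1)) = A + 2 * (A / (x - 1) - 1) - (x - 1) := by
      field_simp
      ring
    rw [this]
    linarith

theorem Supplies.collapse_iterate {d k : ℕ} [NeZero d] (hk : 2 ≤ k) {B : Board d} {j A : ℕ}
    (hA : 1 ≤ A) (h : Supplies k B (slice d j) A) (n : ℕ) (hn : j + n < d) :
    ∃ A', 1 ≤ A' ∧ Supplies k B (slice d (j + n)) A' ∧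
      ((knacciConst k + 1) / (knacciConst k - 1)) ^ n * (A - (knacciConst k - 1)) ≤
        A' - (knacciConst k - 1) := by
  obtain ⟨h1, -, -⟩ := knacciConst_spec hk
  induction n with
  | zero => exact ⟨A, hA, h, by simp⟩
  | succ n ih =>
    obtain ⟨A₁, hA₁, hs₁, hle₁⟩ := ih (by omega)
    obtain ⟨A₂, hA₂, hs₂, hle₂⟩ := hs₁.collapse hk hA₁ (by omega)
    refine ⟨A₂, hA₂, hs₂, le_trans ?_ hle₂⟩
    rw [pow_succ', mul_assoc]
    exact mul_le_mul_of_nonneg_left hle₁ (div_nonneg (by linarith) (by linarith))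

/-- Once everything is collapsed onto the vertical axis, the half-line below row `0` brings a
checker to row `n + 1` as soon as its weight, seen from that row, exceeds `1`. -/
theorem mem_attainableRows_of_supplies {d k m : ℕ} [NeZero d] (hk : 2 ≤ k) {A n : ℕ}
    (h : Supplies k (initialBoard d m) (slice d (d - 1)) A)
    (hA : knacciConst k ^ n * (knacciConst k - 1) < A) :
    (n : ℤ) + 1 ∈ attainableRows d m k := by
  classical
  obtain ⟨h1, -, -⟩ := knacciConst_spec hk
  set x := knacciConst k with hxdef
  have hA0 : (0 : ℝ) < A := lt_of_le_of_lt (mul_nonneg (by positivity) (by linarith)) hA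
  obtain ⟨L, hL⟩ := exists_lt_sum_inv_knacciConst_pow hk (y := x ^ n / A)
    (by rw [div_mul_eq_mul_div, div_lt_one hA0]; exact hA)
  set v : Fin d → ℤ := Pi.single 0 1
  set p : Fin d → ℤ := Pi.single 0 ((n : ℤ) + 1)
  have hray := yields_ray hk (isUnitDirection_single (0 : Fin d)) (L := n + L) (e := 1)
    (c := fun t => if n ≤ t then A else 0) p
    (fun s t hst => by dsimp only; split_ifs <;> omega) (by
      rw [Finset.sum_range_add, Finset.sum_eq_zero, zero_add]
      · have : ∑ t ∈ Finset.range L, ((if n ≤ n + t then A else 0 : ℕ) : ℝ) * x⁻¹ ^ (n + t + 1) =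
            A * (∑ t ∈ Finset.range L, x⁻¹ ^ (t + 1)) / x ^ n := by
          rw [Finset.mul_sum, Finset.sum_div]
          refine Finset.sum_congr rfl fun t _ => ?_
          rw [if_pos (by omega), add_assoc, pow_add, inv_pow x n]
          field_simp
        rw [this, Nat.cast_one, lt_div_iff₀ (by positivity), one_mul]
        rwa [div_lt_iff₀' hA0] at hL
      · intro t ht
        simp [Finset.mem_range.mp ht])
  rw [one_smul, add_assoc, Finset.sum_range_add, Finset.sum_eq_zero, zero_add] at hray
  · have hsup := h ((Finset.range (L + k)).image fun t => p - (n + t + 1) • v) (by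
      intro z hz
      obtain ⟨t, -, rfl⟩ := Finset.mem_image.mp (Finset.mem_coe.mp hz)
      refine ⟨?_, fun i hi _ => ?_⟩
      · simp [p, v]
      · simp [p, v, hi])
    rw [Finset.sum_image] at hsup
    · have hle : A • ∑ t ∈ Finset.range (L + k), checker (p - (n + t + 1) • v) =
          ∑ t ∈ Finset.range (L + k),
            (if n ≤ n + t then A else 0) • checker (p - (n + t + 1) • v) := by
        rw [Finset.smul_sum]
        exact Finset.sum_congr rfl fun t _ => by rw [if_pos (by omega)]
      rw [hle] at hsup
      obtain ⟨R, hR⟩ := hsup.trans hray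
      exact ⟨checker p + R, hR, p, by simp [p], by simp [checker]⟩
    · intro t _ t' _ htt
      have := congrFun htt 0
      simp [p, v] at this
      omega
  · intro t ht
    simp [Finset.mem_range.mp ht]

/-! ### A plane of single checkers in the game with `k = 2` -/

theorem yields_of_eq_add {d k : ℕ} {B T R : Board d} (h : B = T + R) : Yields k B T :=
  yields_of_le (h ▸ le_self_add)

/-- The rounded collapse of a plane of single checkers gives only `1 → 3 → 11` checkers at a cell
`y`. Here the cells off the lines used for that are put to use as well: the columns `a = 3` and
`a = 4` yield three checkers each at `y + 3 u` and `y + 4 u`, which bring one more checker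
to `y`. -/
theorem yields_plane {d : ℕ} {u w : Fin d → ℤ} (hu : IsUnitDirection u) (hw : IsUnitDirection w)
    (y : Fin d → ℤ) :
    Yields 2 (∑ a ∈ Finset.Icc (-2 : ℤ) 4, ∑ b ∈ Finset.Icc (-4 : ℤ) 4,
      checker (y + a • u + b • w)) (12 • checker y) := by
  set g : ℤ → ℤ → Board d := fun a b => checker (y + a • u + b • w)
  have hI : Finset.Icc (-2 : ℤ) 4 = {-2, -1, 0, 1, 2, 3, 4} := by decide
  have hJ : Finset.Icc (-4 : ℤ) 4 = {-4, -3, -2, -1, 0, 1, 2, 3, 4} := by decide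
  have jump : ∀ {v : Fin d → ℤ} (_ : IsUnitDirection v) (p : Fin d → ℤ),
      Yields 2 (checker (p - v) + checker (p - (2 : ℤ) • v)) (checker p) := by
    intro v hv p
    have h := yields_jump (k := 2) hv p
    rw [Finset.sum_range_succ, Finset.sum_range_one] at h
    convert h using 3
    · simp
    · norm_cast
  have jr : ∀ a b, Yields 2 (g (a + 1) b + g (a + 2) b) (g a b) := fun a b => by
    convert jump hu.neg (y + a • u + b • w) using 3 <;> module
  have jl : ∀ a b, Yields 2 (g (a - 1) b + g (a - 2) b) (g a b) := fun a b => by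
    convert jump hu (y + a • u + b • w) using 3 <;> module
  have ju : ∀ a b, Yields 2 (g a (b + 1) + g a (b + 2)) (g a b) := fun a b => by
    convert jump hw.neg (y + a • u + b • w) using 3 <;> module
  have jd : ∀ a b, Yields 2 (g a (b - 1) + g a (b - 2)) (g a b) := fun a b => by
    convert jump hw (y + a • u + b • w) using 3 <;> module
  have hrow : ∀ b, Yields 2 (∑ a ∈ Finset.Icc (-2 : ℤ) 4, g a b)
      (3 • g 0 b + (g 3 b + g 4 b)) := by
    intro b
    have h := ((jr 0 b).add (jl 0 b)).add (yields_of_le (le_refl (g 0 b + (g 3 b + g 4 b))))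
    convert h using 1
    · rw [hI]
      simp [Finset.sum_insert]
      abel
    · abel
  have hcol : ∀ a, Yields 2 (∑ b ∈ Finset.Icc (-4 : ℤ) 4, g a b) (3 • g a 0) := by
    intro a
    have h := ((ju a 0).add (jd a 0)).add (yields_of_le (le_refl (g a 0)))
    refine Yields.trans (yields_of_eq_add (R := g a (-4) + g a (-3) + g a 3 + g a 4) ?_)
      (by convert h using 1; abel)
    rw [hJ]
    simp [Finset.sum_insert]
    abel
  have hfour : ∀ f : ℕ → Board d, (∀ i, Yields 2 (f (i + 1) + f (i + 2)) (f i)) →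
      Yields 2 (3 • (f 1 + f 2 + f 3 + f 4)) (4 • f 0) := by
    intro f hf
    have h₁ : Yields 2 (3 • (f 1 + f 2 + f 3 + f 4)) (3 • f 1 + 5 • f 2 + f 3) := by
      refine Yields.trans (yields_of_eq_add (T := 2 • (f 3 + f 4) + (3 • f 1 + 3 • f 2 + f 3))
        (R := f 4) (by abel)) ?_
      convert ((hf 2).nsmul 2).add (yields_of_le (le_refl (3 • f 1 + 3 • f 2 + f 3))) using 1
      abel
    have h₂ : Yields 2 (3 • f 1 + 5 • f 2 + f 3) (4 • (f 1 + f 2)) := by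
      convert (hf 1).add (yields_of_le (le_refl (3 • f 1 + 4 • f 2))) using 1 <;> abel
    exact (h₁.trans h₂).trans ((hf 0).nsmul 4)
  have hcentre : Yields 2 (∑ b ∈ Finset.Icc (-4 : ℤ) 4, 3 • g 0 b) (11 • g 0 0) := by
    have hup := hfour (fun i => g 0 i) fun i => by
      convert ju 0 i using 3 <;> push_cast <;> ring_nf
    have hdown := hfour (fun i => g 0 (-i)) fun i => by
      convert jd 0 (-i) using 3 <;> push_cast <;> ring_nf
    have h := (hup.add hdown).add (yields_of_le (le_refl (3 • g 0 0)))
    convert h using 1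
    · rw [hJ]
      simp [Finset.sum_insert]
      abel
    · simp only [Nat.cast_zero, neg_zero]
      abel
  have hside : Yields 2 (3 • g 3 0 + 3 • g 4 0) (g 0 0) := by
    have h₁ : Yields 2 (3 • g 3 0 + 3 • g 4 0) (g 2 0 + (g 2 0 + g 3 0)) := by
      refine Yields.trans (yields_of_eq_add (T := (g 3 0 + g 4 0) + ((g 3 0 + g 4 0) + g 3 0))
        (R := g 4 0) (by abel)) ?_
      exact (jr 2 0).add ((jr 2 0).add (yields_of_le le_rfl))
    have h₂ : Yields 2 (g 2 0 + (g 2 0 + g 3 0)) (g 1 0 + g 2 0) := by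
      rw [add_comm (g 1 0)]
      exact (yields_of_le le_rfl).add (jr 1 0)
    exact (h₁.trans h₂).trans (jr 0 0)
  have hsides := ((hcol 3).add (hcol 4)).trans hside
  have h := yields_sum (Finset.Icc (-4 : ℤ) 4) fun b _ => hrow b
  rw [Finset.sum_comm, Finset.sum_add_distrib, Finset.sum_add_distrib] at h
  convert h.trans (hcentre.add hsides) using 1
  have : g 0 0 = checker y := by simp [g]
  rw [this]
  abel

theorem supplies_twelve {d : ℕ} [NeZero d] (hd : 3 ≤ d) :
    Supplies 2 (initialBoard d 1) (slice d 2) 12 := by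
  set i : Fin d := ⟨1, by omega⟩
  set j : Fin d := ⟨2, by omega⟩
  have hi : i ≠ 0 := fun h => by simpa [i] using congrArg Fin.val h
  have hj : j ≠ 0 := fun h => by simpa [j] using congrArg Fin.val h
  have hij : i ≠ j := fun h => by simpa [i, j] using congrArg Fin.val h
  set F : ℤ × ℤ → (Fin d → ℤ) := fun q =>
    q.1 • (Pi.single i 1 : Fin d → ℤ) + q.2 • (Pi.single j 1 : Fin d → ℤ)
  have hFi : ∀ q, F q i = q.1 := fun q => by simp [F, hij]
  have hFj : ∀ q, F q j = q.2 := fun q => by simp [F, hij.symm]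
  have hF0 : ∀ q, F q 0 = 0 := fun q => by simp [F, hi.symm, hj.symm]
  refine (supplies_initialBoard d 2 1).of_pattern
    ((Finset.Icc (-2 : ℤ) 4 ×ˢ Finset.Icc (-4 : ℤ) 4).image F) ?_ ?_ ?_
  · rintro y ⟨hy0, -⟩ f hf
    obtain ⟨q, -, rfl⟩ := Finset.mem_image.mp hf
    refine ⟨?_, fun l hl hl0 => absurd (Fin.ext (by simpa using hl0)) hl⟩
    rw [Pi.add_apply, hF0, add_zero]
    exact hy0
  · rintro y ⟨-, hy⟩ y' ⟨-, hy'⟩ f hf f' hf' heq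
    obtain ⟨q, -, rfl⟩ := Finset.mem_image.mp hf
    obtain ⟨q', -, rfl⟩ := Finset.mem_image.mp hf'
    have h₁ := congrFun heq i
    have h₂ := congrFun heq j
    rw [Pi.add_apply, Pi.add_apply, hFi, hFi, hy i hi (by simp [i]), hy' i hi (by simp [i]),
      zero_add, zero_add] at h₁
    rw [Pi.add_apply, Pi.add_apply, hFj, hFj, hy j hj le_rfl, hy' j hj le_rfl,
      zero_add, zero_add] at h₂
    rw [Prod.ext h₁ h₂] at heq
    exact add_right_cancel heq
  · intro y _
    rw [Finset.sum_image, Finset.sum_product, one_smul]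
    · simpa only [F, add_assoc] using
        yields_plane (isUnitDirection_single i) (isUnitDirection_single j) y
    · intro q _ q' _ heq
      have h₁ := congrFun heq i
      have h₂ := congrFun heq j
      rw [hFi, hFi] at h₁
      rw [hFj, hFj] at h₂
      exact Prod.ext h₁ h₂

/-! ### The weight of a board -/

open scoped ENNReal

/-- The total weight of `B` seen from the cell `y`: a checker at taxicab distance `D` from `y`
weighs `φ ^ (-D)`. It is `ℝ≥0∞`-valued, so that boards with infinitely many checkers need no
summability discussion. -/
noncomputable def boardWeight {d : ℕ} (k : ℕ) (y : Fin d → ℤ) : Board d →+ ℝ≥0∞ where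
  toFun B := ∑' x, (B x : ℝ≥0∞) * ENNReal.ofReal (∏ i, (knacciConst k)⁻¹ ^ (x i - y i).natAbs)
  map_zero' := by simp
  map_add' B C := by
    rw [← ENNReal.tsum_add]
    simp [add_mul]

theorem boardWeight_checker {d : ℕ} (k : ℕ) (y x : Fin d → ℤ) :
    boardWeight k y (checker x) =
      ENNReal.ofReal (∏ i, (knacciConst k)⁻¹ ^ (x i - y i).natAbs) := by
  change ∑' z, _ = _
  rw [tsum_eq_single x]
  · simp [checker]
  · intro z hz
    simp [checker, Pi.single_eq_of_ne hz]

theorem one_le_boardWeight {d k : ℕ} {B : Board d} {y : Fin d → ℤ} (h : 1 ≤ B y) :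
    1 ≤ boardWeight k y B := by
  refine le_trans ?_ (ENNReal.le_tsum y)
  simpa using h

theorem sum_inv_knacciConst_pow_sub {k : ℕ} (hk : 2 ≤ k) :
    ∑ j ∈ Finset.range k, (knacciConst k)⁻¹ ^ (k - j) = 1 := by
  obtain ⟨h1, -, -⟩ := knacciConst_spec hk
  have h : ∑ j ∈ Finset.range k, (knacciConst k)⁻¹ ^ (k - j) =
      ∑ j ∈ Finset.range k, (knacciConst k)⁻¹ ^ (j + 1) := by
    rw [← Finset.sum_range_reflect]
    refine Finset.sum_congr rfl fun j hj => ?_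
    have := Finset.mem_range.mp hj
    congr 1
    omega
  simp only [h, pow_succ, ← Finset.sum_mul]
  rw [sum_inv_knacciConst_pow hk]
  exact mul_inv_cancel₀ (by positivity)

/-- No move increases the weight: in the extreme case of a jump straight towards `y` the landing
checker weighs as much as the `k` checkers it replaces, since `φ⁻¹ + ⋯ + φ⁻ᵏ = 1`; the general case
is the triangle inequality. -/
theorem boardWeight_jump_le {d k : ℕ} (hk : 2 ≤ k) {v : Fin d → ℤ} (hv : IsUnitDirection v)
    (x y : Fin d → ℤ) : boardWeight k y (checker (x + k • v)) ≤
      boardWeight k y (∑ j ∈ Finset.range k, checker (x + j • v)) := by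
  obtain ⟨h1, -, -⟩ := knacciConst_spec hk
  have hs0 : 0 ≤ (knacciConst k)⁻¹ := by positivity
  have hv1 : ∑ i, (v i).natAbs = 1 := by
    obtain ⟨i, rfl | rfl⟩ := hv <;>
    · rw [Finset.sum_eq_single i (fun j _ hj => by simp [hj]) (by simp)]
      simp
  rw [map_sum]
  simp only [boardWeight_checker, Finset.prod_pow_eq_pow_sum]
  rw [← ENNReal.ofReal_sum_of_nonneg fun _ _ => by positivity]
  apply ENNReal.ofReal_le_ofReal
  rw [← mul_one ((knacciConst k)⁻¹ ^ _), ← sum_inv_knacciConst_pow_sub hk, Finset.mul_sum]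
  refine Finset.sum_le_sum fun j hj => ?_
  rw [← pow_add]
  refine pow_le_pow_of_le_one hs0 (inv_le_one_of_one_le₀ h1.le) ?_
  have hj := Finset.mem_range.mp hj
  calc ∑ i, ((x + j • v) i - y i).natAbs
      ≤ ∑ i, (((x + k • v) i - y i).natAbs + (k - j) * (v i).natAbs) := by
        refine Finset.sum_le_sum fun i _ => ?_
        have h2 : (x + j • v) i - y i = ((x + k • v) i - y i) + -(((k - j : ℕ) : ℤ) * v i) := by
          simp only [Pi.add_apply, nsmul_eq_mul, Pi.mul_apply, Pi.natCast_apply]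
          push_cast [hj.le]
          ring
        have h3 := Int.natAbs_add_le ((x + k • v) i - y i) (-(((k - j : ℕ) : ℤ) * v i))
        rwa [← h2, Int.natAbs_neg, Int.natAbs_mul, Int.natAbs_natCast] at h3
    _ = ∑ i, ((x + k • v) i - y i).natAbs + (k - j) := by
        rw [Finset.sum_add_distrib, ← Finset.mul_sum, hv1, mul_one]

theorem Move.boardWeight_le {d k : ℕ} (hk : 2 ≤ k) {B B' : Board d} (h : Move k B B')
    (y : Fin d → ℤ) : boardWeight k y B' ≤ boardWeight k y B := by
  obtain ⟨x, v, hv, hle, rfl⟩ := move_iff.mp h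
  set s := ∑ j ∈ Finset.range k, checker (x + j • v)
  have hfin : boardWeight k y s ≠ ∞ := by
    rw [map_sum]
    refine (ENNReal.sum_lt_top.mpr fun j _ => ?_).ne
    rw [boardWeight_checker]
    exact ENNReal.ofReal_lt_top
  calc boardWeight k y (B - s + checker (x + k • v))
      ≤ boardWeight k y (B - s) + boardWeight k y s := by
        rw [map_add]
        gcongr
        exact boardWeight_jump_le hk hv x y
    _ = boardWeight k y B := by rw [← map_add, tsub_add_cancel_of_le hle]

theorem Attainable.boardWeight_le {d k m : ℕ} [NeZero d] (hk : 2 ≤ k) {B : Board d}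
    (h : Attainable d m k B) (y : Fin d → ℤ) :
    boardWeight k y B ≤ boardWeight k y (initialBoard d m) := by
  induction h with
  | refl => exact le_rfl
  | tail _ h ih => exact (h.boardWeight_le hk y).trans ih

theorem tsum_prod_le_prod_tsum {ι α : Type*} [Fintype ι] (f : ι → α → ℝ≥0∞) :
    ∑' x : ι → α, ∏ i, f i (x i) ≤ ∏ i, ∑' z, f i z := by
  classical
  refine ENNReal.summable.tsum_le_of_sum_le fun s => ?_
  calc ∑ x ∈ s, ∏ i, f i (x i)
      ≤ ∑ x ∈ Fintype.piFinset fun i => s.image fun x => x i, ∏ i, f i (x i) := by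
        refine Finset.sum_le_sum_of_subset fun x hx => ?_
        exact Fintype.mem_piFinset.mpr fun i => Finset.mem_image_of_mem _ hx
    _ = ∏ i, ∑ z ∈ s.image fun x => x i, f i z := by rw [Finset.prod_univ_sum]
    _ ≤ ∏ i, ∑' z, f i z := Finset.prod_le_prod' fun i _ => ENNReal.sum_le_tsum _

theorem hasSum_int_pow_natAbs {s : ℝ} (hs0 : 0 ≤ s) (hs1 : s < 1) (a : ℤ) :
    HasSum (fun z : ℤ => s ^ (z - a).natAbs) ((1 + s) / (1 - s)) := by
  have hg := hasSum_geometric_of_lt_one hs0 hs1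
  have hneg : HasSum (fun n : ℕ => s ^ (-((n : ℤ) + 1)).natAbs) (s * (1 - s)⁻¹) := by
    have e : ∀ n : ℕ, s ^ (-((n : ℤ) + 1)).natAbs = s * s ^ n := fun n => by
      rw [← pow_succ']
      congr 1
    simpa only [e] using hg.mul_left s
  have h := HasSum.of_nat_of_neg_add_one (f := fun z : ℤ => s ^ z.natAbs)
    (by simpa only [Int.natAbs_natCast] using hg) hneg
  rw [show (1 - s)⁻¹ + s * (1 - s)⁻¹ = (1 + s) / (1 - s) by ring] at h
  have h' := (Equiv.subRight a).hasSum_iff.mpr h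
  simpa only [Function.comp_def, Equiv.subRight_apply] using h'

theorem hasSum_int_nonpos_pow_natAbs {s : ℝ} (hs0 : 0 ≤ s) (hs1 : s < 1) (n : ℕ) :
    HasSum (fun z : ℤ => if z ≤ 0 then s ^ (z - n).natAbs else 0) (s ^ n / (1 - s)) := by
  have hg := (hasSum_geometric_of_lt_one hs0 hs1).mul_left (s ^ n)
  have hpos : ∀ t : ℕ, (if -(t : ℤ) ≤ 0 then s ^ (-(t : ℤ) - n).natAbs else 0) = s ^ n * s ^ t :=
    fun t => by
      rw [if_pos (by omega), ← pow_add]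
      congr 1
      omega
  have hneg : ∀ t : ℕ, (if -(-((t : ℤ) + 1)) ≤ 0 then s ^ (-(-((t : ℤ) + 1)) - n).natAbs else 0) =
      0 := fun t => if_neg (by omega)
  have h := HasSum.of_nat_of_neg_add_one
    (f := fun z : ℤ => if -z ≤ 0 then s ^ (-z - n).natAbs else 0) (m' := 0)
    (by simpa only [hpos] using hg) (by simpa only [hneg] using hasSum_zero)
  rw [add_zero, ← div_eq_mul_inv] at h
  exact (Equiv.neg ℤ).hasSum_iff.mp h

theorem boardWeight_initialBoard_le {d k : ℕ} [NeZero d] (hk : 2 ≤ k) (m n : ℕ)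
    {y : Fin d → ℤ} (hy : y 0 = n) :
    boardWeight k y (initialBoard d m) ≤ ENNReal.ofReal (m *
      ((knacciConst k)⁻¹ ^ n / (1 - (knacciConst k)⁻¹) *
        ((1 + (knacciConst k)⁻¹) / (1 - (knacciConst k)⁻¹)) ^ (d - 1))) := by
  obtain ⟨h1, -, -⟩ := knacciConst_spec hk
  have hs0 : 0 ≤ (knacciConst k)⁻¹ := by positivity
  have hs1 : (knacciConst k)⁻¹ < 1 := inv_lt_one_of_one_lt₀ h1
  set s := (knacciConst k)⁻¹
  set f : Fin d → ℤ → ℝ := fun i z => if i = 0 ∧ ¬ z ≤ 0 then 0 else s ^ (z - y i).natAbs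
  have hf0 : ∀ i z, 0 ≤ f i z := fun i z => by
    dsimp only [f]
    split_ifs <;> positivity
  have hle : boardWeight k y (initialBoard d m) ≤
      ∑' x : Fin d → ℤ, (m : ℝ≥0∞) * ∏ i, ENNReal.ofReal (f i (x i)) := by
    refine ENNReal.tsum_le_tsum fun x => ?_
    rw [← ENNReal.ofReal_prod_of_nonneg fun i _ => hf0 i _]
    by_cases hx : x 0 ≤ 0
    · rw [initialBoard, if_pos hx]
      refine le_of_eq ?_
      congr 2
      refine Finset.prod_congr rfl fun i _ => ?_
      rw [show f i (x i) = s ^ (x i - y i).natAbs from if_neg (by rintro ⟨rfl, h⟩; exact h hx)]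
    · simp [initialBoard, hx]
  have h₀ : HasSum (f 0) (s ^ n / (1 - s)) := by
    convert hasSum_int_nonpos_pow_natAbs hs0 hs1 n using 2 with z
    simp only [f, true_and, hy]
    split_ifs <;> simp_all
  have h₁ : ∀ i, i ≠ 0 → HasSum (f i) ((1 + s) / (1 - s)) := by
    intro i hi
    convert hasSum_int_pow_natAbs hs0 hs1 (y i) using 2 with z
    simp [f, hi]
  have htsum : ∀ {i : Fin d} {a : ℝ}, HasSum (f i) a →
      ∑' z, ENNReal.ofReal (f i z) = ENNReal.ofReal a := fun {i a} h => by
    rw [← ENNReal.ofReal_tsum_of_nonneg (hf0 i) h.summable, h.tsum_eq]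
  refine hle.trans ?_
  rw [ENNReal.tsum_mul_left, ENNReal.ofReal_mul (Nat.cast_nonneg m), ENNReal.ofReal_natCast]
  gcongr
  refine (tsum_prod_le_prod_tsum fun i z => ENNReal.ofReal (f i z)).trans (le_of_eq ?_)
  have herase : ∏ i ∈ Finset.univ.erase (0 : Fin d), ∑' z, ENNReal.ofReal (f i z) =
      ENNReal.ofReal ((1 + s) / (1 - s)) ^ (d - 1) := by
    rw [Finset.prod_congr rfl fun i hi => htsum (h₁ i (Finset.ne_of_mem_erase hi)),
      Finset.prod_const, Finset.card_erase_of_mem (Finset.mem_univ _), Finset.card_univ,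
      Fintype.card_fin]
  rw [← Finset.mul_prod_erase _ _ (Finset.mem_univ (0 : Fin d)), htsum h₀, herase,
    ← ENNReal.ofReal_pow (div_nonneg (by positivity) (by linarith)),
    ← ENNReal.ofReal_mul (div_nonneg (by positivity) (by linarith))]

/-- The constant `(φ + 1) ^ (d - 1) / (φ - 1) ^ d`, where `φ` is the `k`-nacci constant: the
initial board of the `(m, k)`-game weighs `m * gain d k` seen from a cell of row `1`. -/
noncomputable def gain (d k : ℕ) : ℝ :=
  (knacciConst k + 1) ^ (d - 1) / (knacciConst k - 1) ^ d

theorem pow_le_of_mem_attainableRows {d k m n : ℕ} [NeZero d] (hk : 2 ≤ k)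
    (h : (n : ℤ) + 1 ∈ attainableRows d m k) : knacciConst k ^ n ≤ m * gain d k := by
  obtain ⟨B, hB, y, hy, hBy⟩ := h
  have hw := (one_le_boardWeight hBy).trans ((hB.boardWeight_le hk y).trans
    (boardWeight_initialBoard_le hk m (n + 1) (by simpa using hy)))
  rw [← ENNReal.ofReal_one, ENNReal.ofReal_le_ofReal_iff'] at hw
  obtain ⟨h1, -, -⟩ := knacciConst_spec hk
  rw [gain]
  have hw := hw.resolve_right (by norm_num)
  obtain ⟨e, rfl⟩ : ∃ e, d = e + 1 := ⟨d - 1, (Nat.sub_add_cancel (NeZero.pos d)).symm⟩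
  rw [Nat.add_sub_cancel] at hw ⊢
  set x := knacciConst k
  have hx : x ≠ 0 := by positivity
  have hx1 : x - 1 ≠ 0 := by linarith
  have e1 : (1 + x⁻¹) / (1 - x⁻¹) = (x + 1) / (x - 1) := by
    have : 1 - x⁻¹ = (x - 1) / x := by field_simp
    rw [this]
    field_simp
  have e2 : x⁻¹ ^ (n + 1) / (1 - x⁻¹) = (x ^ n)⁻¹ / (x - 1) := by
    have : 1 - x⁻¹ = (x - 1) / x := by field_simp
    rw [this, inv_pow, pow_succ]
    field_simp
  rw [e1, e2, div_pow] at hw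
  have e3 : (m : ℝ) * ((x ^ n)⁻¹ / (x - 1) * ((x + 1) ^ e / (x - 1) ^ e)) =
      m * ((x + 1) ^ e / (x - 1) ^ (e + 1)) / x ^ n := by
    rw [pow_succ (x - 1)]
    field_simp
  rwa [e3, le_div_iff₀ (by positivity), one_mul] at hw

/-! ### Natural density -/

/-- A property of density `1`: the exceptions `m` are such that `m * C` lies within a bounded
distance above a power of `x > 1`, so there are only `O(log N)` of them up to `N`. -/
theorem forAlmostAllNat_of_sparse {P : ℕ → Prop} {x C c : ℝ} (hx : 1 < x) (hC : 0 < C)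
    (h : ∀ m : ℕ, 1 ≤ m → ¬ P m → ∃ j : ℕ, x ^ j ≤ m * C ∧ m * C < x ^ j + c) :
    ForAlmostAllNat P := by
  classical
  set K := ⌈c / C⌉₊
  have hlx : 0 < Real.log x := Real.log_pos hx
  have hcard : ∀ N : ℕ, 1 ≤ N → (((Finset.Icc 1 N).filter fun m => ¬ P m).card : ℝ) ≤
      (Real.log N / Real.log x + (|Real.log C| / Real.log x + 1)) * (K + 1) := by
    intro N hN
    have hN0 : (0 : ℝ) < N := by exact_mod_cast hN
    have hlogN : 0 ≤ Real.log N := Real.log_nonneg (by exact_mod_cast hN)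
    set y := Real.log N / Real.log x + |Real.log C| / Real.log x
    have hy : 0 ≤ y := by positivity
    have hsub : ((Finset.Icc 1 N).filter fun m => ¬ P m) ⊆
        (Finset.range (⌊y⌋₊ + 1)).biUnion fun j =>
          Finset.Icc ⌈x ^ j / C⌉₊ (⌈x ^ j / C⌉₊ + K) := by
      intro m hm
      obtain ⟨hmN, hmP⟩ := Finset.mem_filter.mp hm
      obtain ⟨hm1, hmN⟩ := Finset.mem_Icc.mp hmN
      obtain ⟨j, hj₁, hj₂⟩ := h m hm1 hmP
      have hmN' : (m : ℝ) ≤ N := by exact_mod_cast hmN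
      refine Finset.mem_biUnion.mpr ⟨j, ?_, Finset.mem_Icc.mpr ⟨?_, ?_⟩⟩
      · rw [Finset.mem_range, Nat.lt_succ_iff]
        apply Nat.le_floor
        have h1 : x ^ j ≤ N * C := hj₁.trans (by gcongr)
        have h2 := Real.log_le_log (by positivity) h1
        rw [Real.log_pow, Real.log_mul hN0.ne' hC.ne'] at h2
        rw [show y = (Real.log N + |Real.log C|) / Real.log x from (add_div ..).symm,
          le_div_iff₀ hlx]
        linarith [le_abs_self (Real.log C)]
      · rw [Nat.ceil_le, div_le_iff₀ hC]
        exact hj₁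
      · have h1 : (m : ℝ) < x ^ j / C + c / C := by
          rw [← add_div, lt_div_iff₀ hC]
          exact hj₂
        have h2 := Nat.le_ceil (x ^ j / C)
        have h3 := Nat.le_ceil (c / C)
        have h4 : (m : ℝ) < (⌈x ^ j / C⌉₊ + K : ℕ) := by
          push_cast
          linarith
        exact_mod_cast h4.le
    have hle := (Finset.card_le_card hsub).trans
      (Finset.card_biUnion_le_card_mul _ _ (K + 1) fun j _ => by simp; omega)
    rw [Finset.card_range] at hle
    have hle' : (((Finset.Icc 1 N).filter fun m => ¬ P m).card : ℝ) ≤ (⌊y⌋₊ + 1) * (K + 1) := by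
      exact_mod_cast hle
    refine hle'.trans ?_
    rw [← add_assoc]
    gcongr
    exact Nat.floor_le hy
  have hgood : ∀ N : ℕ, ({m : ℕ | 1 ≤ m ∧ m ≤ N ∧ P m}.ncard : ℝ) =
      N - ((Finset.Icc 1 N).filter fun m => ¬ P m).card := by
    intro N
    have hset : {m : ℕ | 1 ≤ m ∧ m ≤ N ∧ P m} = ((Finset.Icc 1 N).filter P : Finset ℕ) := by
      ext m
      simp [and_assoc]
    have hadd := Finset.card_filter_add_card_filter_not (s := Finset.Icc 1 N) P
    rw [Nat.card_Icc, Nat.add_sub_cancel] at hadd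
    rw [hset, Set.ncard_coe_finset, eq_sub_iff_add_eq]
    exact_mod_cast hadd
  have hlog : Filter.Tendsto (fun N : ℕ => Real.log N / N) Filter.atTop (nhds 0) := by
    have := (Real.tendsto_pow_log_div_mul_add_atTop 1 0 1 one_ne_zero).comp
      (tendsto_natCast_atTop_atTop (R := ℝ))
    simpa [Function.comp_def] using this
  have hconst := tendsto_const_div_atTop_nhds_zero_nat (|Real.log C| / Real.log x + 1)
  have hlim : Filter.Tendsto (fun N : ℕ => 1 - (Real.log N / N / Real.log x +
      (|Real.log C| / Real.log x + 1) / N) * (K + 1)) Filter.atTop (nhds 1) := by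
    have := (((hlog.div_const (Real.log x)).add hconst).mul_const ((K : ℝ) + 1)).const_sub 1
    simpa using this
  refine tendsto_of_tendsto_of_tendsto_of_le_of_le' hlim tendsto_const_nhds ?_ ?_
  · filter_upwards [Filter.eventually_ge_atTop 1] with N hN
    have hN0 : (0 : ℝ) < N := by exact_mod_cast hN
    rw [hgood, sub_div, div_self hN0.ne']
    have := div_le_div_of_nonneg_right (hcard N hN) hN0.le
    have e : (Real.log N / Real.log x + (|Real.log C| / Real.log x + 1)) * (K + 1) / N =
        (Real.log N / N / Real.log x + (|Real.log C| / Real.log x + 1) / N) * (K + 1) := by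
      field_simp
    linarith
  · filter_upwards [Filter.eventually_ge_atTop 1] with N hN
    have hN0 : (0 : ℝ) < N := by exact_mod_cast hN
    rw [hgood, div_le_one hN0]
    exact sub_le_self _ (Nat.cast_nonneg _)

/-! ### Attainable rows -/

theorem one_le_gain {k : ℕ} (hk : 2 ≤ k) (d : ℕ) : 1 ≤ gain d k := by
  obtain ⟨h1, h2, -⟩ := knacciConst_spec hk
  have hpos : 0 < knacciConst k - 1 := by linarith
  rw [gain, le_div_iff₀ (by positivity), one_mul]
  exact (pow_le_one₀ hpos.le (by linarith)).trans (one_le_pow₀ (by linarith))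

theorem gain_mul {d k : ℕ} [NeZero d] (hk : 2 ≤ k) : gain d k * (knacciConst k - 1) =
    ((knacciConst k + 1) / (knacciConst k - 1)) ^ (d - 1) := by
  obtain ⟨h1, -, -⟩ := knacciConst_spec hk
  have hpos : knacciConst k - 1 ≠ 0 := by linarith
  obtain ⟨e, rfl⟩ : ∃ e, d = e + 1 := ⟨d - 1, (Nat.sub_add_cancel (NeZero.pos d)).symm⟩
  rw [gain, Nat.add_sub_cancel, div_pow, pow_succ (knacciConst k - 1)]
  field_simp

theorem floor_logb_eq {b x : ℝ} (hb : 1 < b) {j : ℕ} (h₁ : b ^ j ≤ x) (h₂ : x < b ^ (j + 1)) :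
    ⌊Real.logb b x⌋ = j := by
  have hx : 0 < x := lt_of_lt_of_le (by positivity) h₁
  rw [Int.floor_eq_iff]
  constructor
  · rw [Real.le_logb_iff_rpow_le hb hx]
    simpa using h₁
  · rw [Real.logb_lt_iff_lt_rpow hb hx]
    exact_mod_cast h₂

theorem exists_rowBound_eq {k m : ℕ} (hk : 2 ≤ k) (hm : 1 ≤ m) (d : ℕ) :
    ∃ j : ℕ, rowBound d m k = j ∧ knacciConst k ^ j ≤ m * gain d k ∧
      m * gain d k < knacciConst k ^ (j + 1) := by
  obtain ⟨h1, -, -⟩ := knacciConst_spec hk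
  have hg := one_le_gain hk d
  have hm' : (1 : ℝ) ≤ m := by exact_mod_cast hm
  obtain ⟨j, hj₁, hj₂⟩ := exists_nat_pow_near (one_le_mul_of_one_le_of_one_le hm' hg) h1
  refine ⟨j, ?_, hj₁, hj₂⟩
  rw [rowBound, ← gain, ← Real.logb_mul (by linarith) (by linarith)]
  exact floor_logb_eq h1 hj₁ hj₂

theorem le_of_mem_attainableRows {d k m j : ℕ} [NeZero d] (hk : 2 ≤ k)
    (hj : m * gain d k < knacciConst k ^ (j + 1)) {n : ℤ} (hn : n ∈ attainableRows d m k) :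
    n ≤ j + 1 := by
  obtain ⟨h1, -, -⟩ := knacciConst_spec hk
  rcases le_or_gt n 0 with h0 | h0
  · omega
  · obtain ⟨i, rfl⟩ : ∃ i : ℕ, n = i + 1 := ⟨(n - 1).toNat, by omega⟩
    have := (pow_lt_pow_iff_right₀ h1).mp ((pow_le_of_mem_attainableRows hk hn).trans_lt hj)
    omega

theorem zero_mem_attainableRows {d m : ℕ} [NeZero d] (k : ℕ) (hm : 1 ≤ m) :
    0 ∈ attainableRows d m k :=
  ⟨initialBoard d m, Relation.ReflTransGen.refl, 0, rfl, by simpa [initialBoard] using hm⟩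

/-- The rounding losses of all collapses together cost at most `φ - 1` of the `m` initial
checkers per cell. -/
theorem mem_attainableRows_of_pow_le {d k m n : ℕ} [NeZero d] (hk : 2 ≤ k) (hm : 1 ≤ m)
    (h : knacciConst k ^ n ≤ (m - (knacciConst k - 1)) * gain d k) :
    (n : ℤ) + 1 ∈ attainableRows d m k := by
  obtain ⟨h1, -, -⟩ := knacciConst_spec hk
  have hpos : 0 < knacciConst k - 1 := by linarith
  have hd := NeZero.pos d
  obtain ⟨A, -, hA, hle⟩ := (supplies_initialBoard d k m).collapse_iterate hk hm (d - 1) (by omega)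
  rw [zero_add] at hA
  refine mem_attainableRows_of_supplies hk hA ?_
  rw [← gain_mul hk] at hle
  have := mul_le_mul_of_nonneg_right h hpos.le
  linarith

theorem mem_attainableRows_of_one_lt {d k m j : ℕ} [NeZero d] (hk : 2 ≤ k) (hm : 1 < m)
    (h : knacciConst k ^ j ≤ m * gain d k) : (j : ℤ) ∈ attainableRows d m k := by
  obtain ⟨h1, h2, -⟩ := knacciConst_spec hk
  obtain _ | j := j
  · exact zero_mem_attainableRows k hm.le
  · push_cast
    refine mem_attainableRows_of_pow_le hk hm.le ?_
    have hm' : (2 : ℝ) ≤ m := by exact_mod_cast hm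
    set x := knacciConst k
    have hx : 0 < x := by linarith
    -- `m ≥ 2 > x` gives `m ≤ x (m - (x - 1))`
    have key : m ≤ (m - (x - 1)) * x := by nlinarith
    have hg : 0 ≤ gain d k := by linarith [one_le_gain hk d]
    have := h.trans (mul_le_mul_of_nonneg_right key hg)
    rw [pow_succ] at this
    exact le_of_mul_le_mul_right (by linarith) hx

theorem exists_isGreatest_of_mem {s : Set ℤ} {a b : ℤ} (ha : a ∈ s) (hb : ∀ n ∈ s, n ≤ b) :
    ∃ n, IsGreatest s n ∧ a ≤ n ∧ n ≤ b := by
  obtain ⟨n, hn, hmax⟩ := Int.exists_greatest_of_bdd ⟨b, hb⟩ ⟨a, ha⟩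
  exact ⟨n, ⟨hn, hmax⟩, hmax a ha, hb n hn⟩

theorem forAlmostAllNat_isGreatest (d : ℕ) [NeZero d] {k : ℕ} (hk : 2 ≤ k) :
    ForAlmostAllNat fun m => IsGreatest (attainableRows d m k) (rowBound d m k + 1) := by
  obtain ⟨h1, -, -⟩ := knacciConst_spec hk
  have hg := one_le_gain hk d
  refine forAlmostAllNat_of_sparse h1 (C := gain d k) (c := (knacciConst k - 1) * gain d k)
    (by linarith) fun m hm hnot => ?_
  obtain ⟨j, hj, hj₁, hj₂⟩ := exists_rowBound_eq hk hm d
  refine ⟨j, hj₁, ?_⟩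
  by_contra! hle
  refine hnot ?_
  rw [hj]
  exact ⟨mem_attainableRows_of_pow_le hk hm (by linarith),
    fun n hn => le_of_mem_attainableRows hk hj₂ hn⟩

/-! ### The golden ratio -/

open Real in
theorem knacciConst_two : knacciConst 2 = goldenRatio := by
  refine ((knacciConst_eq_iff le_rfl goldenRatio_pos).mpr ?_).symm
  simp [Finset.sum_range_succ, goldenRatio_sq, add_comm]

open Real in
theorem goldenRatio_sub_one : goldenRatio - 1 = goldenRatio⁻¹ := by
  have h := goldenRatio_sq
  have h0 := goldenRatio_pos
  refine eq_inv_of_mul_eq_one_left ?_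
  linarith

open Real in
theorem gain_two (d : ℕ) [NeZero d] : gain d 2 = goldenRatio ^ (3 * d - 2) := by
  obtain ⟨e, rfl⟩ : ∃ e, d = e + 1 := ⟨d - 1, (Nat.sub_add_cancel (NeZero.pos d)).symm⟩
  rw [gain, knacciConst_two, goldenRatio_sub_one, ← goldenRatio_sq, ← pow_mul, inv_pow,
    div_inv_eq_mul, ← pow_add]
  congr 1
  omega

open Real in
theorem rowBound_two (d m : ℕ) [NeZero d] :
    rowBound d m 2 = ⌊logb goldenRatio m⌋ + 3 * (d : ℤ) - 2 := by
  have hd := NeZero.pos d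
  rw [rowBound, ← gain, gain_two, knacciConst_two, logb_pow,
    logb_self_eq_one one_lt_goldenRatio, mul_one, Int.floor_add_natCast]
  omega

/-- With a single checker per cell the rounding loss is affordable in dimension at most `2`; in
higher dimension the first two collapses are replaced by `supplies_twelve`, whose better yield
leaves enough room for the losses of the remaining ones. -/
theorem mem_attainableRows_one_two (d : ℕ) [NeZero d] :
    3 * (d : ℤ) - 2 ∈ attainableRows d 1 2 := by
  have hd := NeZero.pos d
  have hx := Real.goldenRatio_sq
  have h1 := Real.one_lt_goldenRatio
  have hratio : (Real.goldenRatio + 1) / (Real.goldenRatio - 1) = Real.goldenRatio ^ 3 := by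
    rw [goldenRatio_sub_one, ← hx]
    field_simp
  have hsub := goldenRatio_sub_one
  rw [show 3 * (d : ℤ) - 2 = ((3 * d - 3 : ℕ) : ℤ) + 1 by omega]
  suffices ∃ A : ℕ, Supplies 2 (initialBoard d 1) (slice d (d - 1)) A ∧
      Real.goldenRatio ^ (3 * d - 3) * (Real.goldenRatio - 1) < A by
    obtain ⟨A, hA, hlt⟩ := this
    exact mem_attainableRows_of_supplies le_rfl hA (by rwa [knacciConst_two])
  have h₀ := supplies_initialBoard d 2 1
  set x := Real.goldenRatio
  obtain rfl | rfl | hd3 : d = 1 ∨ d = 2 ∨ 3 ≤ d := by omega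
  · refine ⟨1, h₀, ?_⟩
    norm_num
    nlinarith
  · obtain ⟨A, -, hA, hle⟩ := h₀.collapse le_rfl le_rfl (by norm_num)
    refine ⟨A, hA, ?_⟩
    rw [knacciConst_two, hratio] at hle
    norm_num at hle ⊢
    have h3 : x ^ 3 = 2 * x + 1 := by
      rw [pow_succ, hx]
      linarith
    rw [h3] at hle ⊢
    -- the bound `√5 ≤ A` suffices since `A` is an integer
    have hA2 : (2 : ℝ) < A := by nlinarith
    have hA3 : (3 : ℝ) ≤ A := by exact_mod_cast hA2
    nlinarith
  · obtain ⟨A, -, hA, hle⟩ := (supplies_twelve hd3).collapse_iterate le_rfl (by norm_num) (d - 3)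
      (by omega)
    rw [show 2 + (d - 3) = d - 1 by omega] at hA
    refine ⟨A, hA, ?_⟩
    rw [knacciConst_two, hratio, ← pow_mul] at hle
    rw [show 3 * d - 3 = 3 * (d - 3) + 6 by omega, pow_add]
    have h6 : x ^ 6 * (x - 1) = 5 * x + 3 := by
      have : x ^ 6 = (x ^ 2) ^ 3 := by ring
      rw [this, hx]
      nlinarith
    have hpow : 0 < x ^ (3 * (d - 3)) := by positivity
    have h7 : x ^ (3 * (d - 3)) * (5 * x + 3) ≤
        x ^ (3 * (d - 3)) * (((12 : ℕ) : ℝ) - (x - 1)) := by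
      refine mul_le_mul_of_nonneg_left ?_ hpow.le
      have : x < 1.65 := by nlinarith
      norm_num
      linarith
    rw [mul_assoc, h6]
    linarith

end ConwayCheckers

open ConwayCheckers in
theorem theorem1 (d : ℕ) [NeZero d] :
    (∀ k : ℕ, 2 ≤ k →
      (∀ m : ℕ, 1 < m → ∃ nM : ℤ, IsGreatest (attainableRows d m k) nM ∧
        rowBound d m k ≤ nM ∧ nM ≤ rowBound d m k + 1) ∧
      ForAlmostAllNat (fun m => IsGreatest (attainableRows d m k) (rowBound d m k + 1))) ∧
    (∀ m : ℕ, 1 ≤ m → ∃ nM : ℤ, IsGreatest (attainableRows d m 2) nM ∧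
      ⌊Real.logb Real.goldenRatio m⌋ + 3 * (d : ℤ) - 2 ≤ nM ∧
      nM ≤ ⌊Real.logb Real.goldenRatio m⌋ + 3 * (d : ℤ) - 1) ∧
    ForAlmostAllNat (fun m => IsGreatest (attainableRows d m 2)
      (⌊Real.logb Real.goldenRatio m⌋ + 3 * (d : ℤ) - 1)) := by
  have hgen : ∀ k : ℕ, 2 ≤ k → ∀ m : ℕ, 1 < m → ∃ nM : ℤ, IsGreatest (attainableRows d m k) nM ∧
      rowBound d m k ≤ nM ∧ nM ≤ rowBound d m k + 1 := by
    intro k hk m hm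
    obtain ⟨j, hj, hj₁, hj₂⟩ := exists_rowBound_eq hk hm.le d
    rw [hj]
    exact exists_isGreatest_of_mem (mem_attainableRows_of_one_lt hk hm hj₁)
      fun n hn => le_of_mem_attainableRows hk hj₂ hn
  refine ⟨fun k hk => ⟨hgen k hk, forAlmostAllNat_isGreatest d hk⟩, fun m hm => ?_, ?_⟩
  · have hrow := rowBound_two d m
    suffices ∃ nM : ℤ, IsGreatest (attainableRows d m 2) nM ∧
        rowBound d m 2 ≤ nM ∧ nM ≤ rowBound d m 2 + 1 by
      obtain ⟨n, hn, hn₁, hn₂⟩ := this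
      exact ⟨n, hn, by omega, by omega⟩
    obtain rfl | hm1 : m = 1 ∨ 1 < m := by omega
    · obtain ⟨j, hj, hj₁, hj₂⟩ := exists_rowBound_eq le_rfl le_rfl d
      refine exists_isGreatest_of_mem ?_ fun n hn => by
        rw [hj]
        exact le_of_mem_attainableRows le_rfl hj₂ hn
      rw [hrow]
      simpa using mem_attainableRows_one_two d
    · exact hgen 2 le_rfl m hm1
  · have hrow : ∀ m : ℕ, ⌊Real.logb Real.goldenRatio m⌋ + 3 * (d : ℤ) - 1 = rowBound d m 2 + 1 :=
      fun m => by rw [rowBound_two]; omega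
    simpa only [hrow] using forAlmostAllNat_isGreatest d (le_refl 2)
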